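/- Let $d$ be a positive integer. For a lattice $\Lambda\subset\mathbb R^d$ of full rank, a compact convex body $M\subset\mathbb R^d$ symmetric about the origin and $1\le p\le d$, let $\lambda_p(M)$ denote the $p$-th successive minimum of $M$ with respect to $\Lambda$, i.e. the infimum of the $r>0$ such that $rM$ contains $p$ linearly independent points of $\Lambda$. Let $\Lambda$ be unimodular (covolume $1$), and let $\tau=(\tau_1,\dots,\tau_d)$ be a path in $\mathbb R^d$, $s\mapsto\tau(s)$, $s>0$, with $\tau_1(s)+\dots+\tau_d(s)=0$ for all $s$. Put $$\mathcal B(s)=\operatorname{diag}\bigl(e^{\tau_1(s)},\dots,e^{\tau_d(s)}\bigr)[-1,1]^d,\qquad \psi_p(s)=\frac{\ln\lambda_p(\mathcal B(s))}{s}\quad(1\le p\le d),$$ $$\underline\Psi_p=\liminf_{s\to+\infty}\sum_{i=1}^p\psi_i(s),\qquad \overline\Psi_p=\limsup_{s\to+\infty}\sum_{i=1}^p\psi_i(s).$$ Then for every such $\Lambda$ and $\tau$ and all $s>0$ $$0\le-\sum_{i=1}^d\psi_i(s)=O(s^{-1}),$$ where the implied constant depends only on $d$. In particular, $$\underline\Psi_d=\overline\Psi_d=\lim_{s\to+\infty}\sum_{i=1}^d\psi_i(s)=0.$$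 -/

import Mathlib

open Filter Topology
open scoped Pointwise

noncomputable section

namespace Schmidt

/-- The `p`-th successive minimum of `M ⊆ ℝ^d` with respect to the lattice `Λ`: the infimum of the
`r > 0` such that `r M` contains `p` linearly independent points of `Λ`. -/
def successiveMinimum {d : ℕ} (Λ : Submodule ℤ (Fin d → ℝ)) (M : Set (Fin d → ℝ)) (p : ℕ) : ℝ :=
  sInf {r : ℝ | 0 < r ∧ ∃ v : Fin p → (Fin d → ℝ),
    LinearIndependent ℝ v ∧ ∀ i, v i ∈ Λ ∧ v i ∈ r • M}

/-- The unit ball of the sup-norm, that is, the cube `[-1, 1]^d`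
(the norm of `Fin d → ℝ` is the sup-norm). -/
def cube (d : ℕ) : Set (Fin d → ℝ) := Metric.closedBall 0 1

/-- The diagonal matrix with `e^{τ_1}, …, e^{τ_d}` on the main diagonal. -/
def diagExp {d : ℕ} (τ : Fin d → ℝ) : Matrix (Fin d) (Fin d) ℝ :=
  Matrix.diagonal fun i => Real.exp (τ i)

/-- The parallelepiped `B(s) = D_{τ(s)} [-1, 1]^d`. -/
def box {d : ℕ} (τ : ℝ → Fin d → ℝ) (s : ℝ) : Set (Fin d → ℝ) :=
  (diagExp (τ s)).mulVec '' cube d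

/-- `ψ_p(Λ, τ, s) = ln(λ_p(B(s))) / s`, for `1 ≤ p ≤ d` and `s > 0`. -/
def psi {d : ℕ} (Λ : Submodule ℤ (Fin d → ℝ)) (τ : ℝ → Fin d → ℝ) (p : ℕ) (s : ℝ) : ℝ :=
  Real.log (successiveMinimum Λ (box τ s) p) / s

/-- `ψ_1(s) + … + ψ_p(s)`. -/
def psiSum {d : ℕ} (Λ : Submodule ℤ (Fin d → ℝ)) (τ : ℝ → Fin d → ℝ) (p : ℕ) (s : ℝ) : ℝ :=
  ∑ i ∈ Finset.Icc 1 p, psi Λ τ i s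

/-- The `p`-th lower Schmidt exponent of the second type, as an extended real number. -/
def lowerPsi {d : ℕ} (Λ : Submodule ℤ (Fin d → ℝ)) (τ : ℝ → Fin d → ℝ) (p : ℕ) : EReal :=
  liminf (fun s : ℝ => (psiSum Λ τ p s : EReal)) atTop

/-- The `p`-th upper Schmidt exponent of the second type, as an extended real number. -/
def upperPsi {d : ℕ} (Λ : Submodule ℤ (Fin d → ℝ)) (τ : ℝ → Fin d → ℝ) (p : ℕ) : EReal :=
  limsup (fun s : ℝ => (psiSum Λ τ p s : EReal)) atTop

end Schmidt

end

/-! Everything rests on Minkowski's second theorem with constants depending only on `d`: `covol/d! ≤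
∏ λ_i ≤ covol` for the cube. Trace-zero diagonal exponentials preserve volume, so the box with `Λ`
becomes the cube with another unimodular lattice; logarithms divided by `s` give `C = log d!`. The
lower bound compares the determinant of independent lattice vectors of nearly minimal length with
the covolume. For the upper bound, a ball is contracted along the flag spanned by short lattice
vectors, keeping volume at least `∏ λ_i`. If this exceeded the covolume, two points would differ by
a nonzero lattice vector (Blichfeldt), which the flag then forces to be ever shorter, hence zero. -/

open MeasureTheory Module

namespace Schmidt

/-! ### Contraction of a set along a subspace -/

section Squeeze

variable {E : Type*} [NormedAddCommGroup E] [NormedSpace ℝ E]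

/-- The linear map that multiplies by `θ` on `V` and is the identity on the complement `W`. -/
noncomputable def squeezeMap {V W : Submodule ℝ E} (h : IsCompl V W) (θ : ℝ) : E →ₗ[ℝ] E :=
  θ • LinearMap.id + (1 - θ) • W.projection V h.symm

theorem squeezeMap_apply {V W : Submodule ℝ E} (h : IsCompl V W) (θ : ℝ) (x : E) :
    squeezeMap h θ x = θ • x + (1 - θ) • W.projection V h.symm x := rfl

variable [FiniteDimensional ℝ E]

theorem det_squeezeMap {V W : Submodule ℝ E} (h : IsCompl V W) (θ : ℝ) :
    LinearMap.det (squeezeMap h θ) = θ ^ finrank ℝ V := by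
  have key : squeezeMap h θ = (V.prodEquivOfIsCompl W h : V × W →ₗ[ℝ] E) ∘ₗ
      (LinearMap.prodMap (θ • LinearMap.id) LinearMap.id) ∘ₗ
        ((V.prodEquivOfIsCompl W h).symm : E →ₗ[ℝ] V × W) := by
    rw [← LinearMap.comp_assoc, LinearEquiv.eq_comp_toLinearMap_symm]
    refine LinearMap.ext fun ⟨v, w⟩ => ?_
    have hv : W.projection V h.symm (v : E) = 0 := by
      simp
    have hw : W.projection V h.symm (w : E) = w := by
      simp
    simp only [LinearMap.comp_apply, LinearEquiv.coe_coe, Submodule.coe_prodEquivOfIsCompl',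
      squeezeMap_apply, map_add, hv, hw, LinearMap.prodMap_apply, LinearMap.smul_apply,
      LinearMap.id_apply, Submodule.coe_smul]
    module
  rw [key, LinearMap.det_conj, LinearMap.det_prodMap]
  simp

variable [MeasurableSpace E] [BorelSpace E] (μ : Measure E) [μ.IsAddHaarMeasure]

/-- **Squeezing lemma.** Inside an open convex set `K`, a measurable set `A` can be contracted by
the factor `θ` in the directions of a subspace `V`. -/
theorem exists_squeeze {K A : Set E} (hKo : IsOpen K) (hKc : Convex ℝ K) (hA : MeasurableSet A)
    (hAK : A ⊆ K) (V : Submodule ℝ E) {θ : ℝ} (hθ : 0 < θ) (hθ1 : θ ≤ 1) :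
    ∃ A' ⊆ K, MeasurableSet A' ∧ μ A' = ENNReal.ofReal (θ ^ finrank ℝ V) * μ A ∧
      ∀ x ∈ A', ∀ y ∈ A', x - y ∈ V → ∃ x' ∈ A, ∃ y' ∈ A, x - y = θ • (x' - y') := by
  obtain ⟨W, h⟩ := V.exists_isCompl
  set Q : E →ₗ[ℝ] E := W.projection V h.symm with hQ
  have hQc : Continuous Q := Q.continuous_of_finiteDimensional
  have hQV : ∀ x, x ∈ V ↔ Q x = 0 := by
    intro x
    rw [← LinearMap.mem_ker, hQ, Submodule.ker_projection]
  have hQQ : ∀ x, Q (Q x) = Q x := by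
    intro x
    exact Submodule.projection_apply_of_mem_left _ (Submodule.projection_apply_mem _ _)
  -- Each fibre of `Q` is contracted towards a centre `v n + Q x` lying in `K`, with `n` the first
  -- index that works. Openness of `K` makes countably many centres suffice.
  let v : ℕ → V := TopologicalSpace.denseSeq V
  let B : ℕ → Set E := fun n => {x | (v n : E) + Q x ∈ K}
  have hB : ∀ n, MeasurableSet (B n) := fun n =>
    (hKo.preimage (continuous_const.add hQc)).measurableSet
  have hBQ : ∀ n x y, Q x = Q y → x ∈ disjointed B n → y ∈ disjointed B n := by
    intro n x y hxy hx
    rw [disjointed_eq_inter_compl] at hx ⊢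
    simpa [B, hxy] using hx
  have hcover : ∀ x ∈ A, ∃ n, x ∈ disjointed B n := by
    intro x hx
    have hopen : IsOpen {u : V | (u : E) + Q x ∈ K} :=
      hKo.preimage (continuous_subtype_val.add continuous_const)
    have hmem : x - Q x ∈ V := by rw [hQV, map_sub, hQQ, sub_self]
    obtain ⟨u, hu, n, rfl⟩ := (TopologicalSpace.denseRange_denseSeq V).inter_open_nonempty _ hopen
      ⟨⟨x - Q x, hmem⟩, by simpa using hAK hx⟩
    have : x ∈ ⋃ n, disjointed B n := by
      rw [iUnion_disjointed]
      exact Set.mem_iUnion.2 ⟨n, hu⟩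
    simpa using this
  let P : ℕ → Set E := fun n => A ∩ disjointed B n
  have hP : ∀ n, MeasurableSet (P n) := fun n => hA.inter (MeasurableSet.disjointed hB n)
  -- On one piece the contraction is affine with linear part `squeezeMap h θ`; it preserves fibres,
  -- and a fibre meets at most one piece.
  let φ : ℕ → E → E := fun n x => ((1 - θ) • (v n : E)) + squeezeMap h θ x
  have hφ : ∀ n x, φ n x = θ • x + (1 - θ) • ((v n : E) + Q x) := by
    intro n x
    simp only [φ, squeezeMap_apply, hQ, smul_add]
    abel
  have hQφ : ∀ n x, Q (φ n x) = Q x := by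
    intro n x
    have : Q (v n : E) = 0 := (hQV _).1 (v n).2
    rw [hφ]
    simp only [map_add, map_smul, hQQ, this]
    module
  have hdet : LinearMap.det (squeezeMap h θ) ≠ 0 := by
    rw [det_squeezeMap]; positivity
  have hμ : ∀ n s, μ (φ n '' s) = ENNReal.ofReal (θ ^ finrank ℝ V) * μ s := by
    intro n s
    have : φ n '' s = (fun x => (1 - θ) • (v n : E) + x) '' (squeezeMap h θ '' s) := by
      rw [Set.image_image]
    rw [this, Set.image_add_left, measure_preimage_add, Measure.addHaar_image_linearMap,
      det_squeezeMap, abs_of_pos (by positivity)]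
  have hmeas : ∀ n, MeasurableSet (φ n '' P n) := by
    intro n
    have : φ n '' P n = (fun x => (1 - θ) • (v n : E) + x) '' (squeezeMap h θ '' P n) := by
      rw [Set.image_image]
    rw [this, Set.image_add_left]
    refine measurable_const_add _ ?_
    let e := (LinearMap.equivOfDetNeZero _ hdet).toContinuousLinearEquiv
    exact e.toHomeomorph.measurableEmbedding.measurableSet_image.2 (hP n)
  have hsame : ∀ n m x y, x ∈ P n → y ∈ P m → Q x = Q y → n = m := by
    intro n m x y hx hy hxy
    by_contra hne
    exact Set.disjoint_left.1 (disjoint_disjointed B hne) (hBQ n x y hxy hx.2) hy.2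
  refine ⟨⋃ n, φ n '' P n, ?_, MeasurableSet.iUnion hmeas, ?_, ?_⟩
  · refine Set.iUnion_subset fun n => ?_
    rintro _ ⟨x, hx, rfl⟩
    rw [hφ]
    exact hKc (hAK hx.1) (disjointed_subset B n hx.2) hθ.le (sub_nonneg.2 hθ1) (by ring)
  · rw [measure_iUnion _ hmeas]
    · simp_rw [hμ, ENNReal.tsum_mul_left]
      congr 1
      rw [← measure_iUnion _ hP]
      · congr 1
        ext x
        simp only [P, Set.mem_iUnion, Set.mem_inter_iff]
        exact ⟨fun ⟨_, hx, _⟩ => hx, fun hx => (hcover x hx).imp fun n hn => ⟨hx, hn⟩⟩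
      · exact fun n m hnm => (disjoint_disjointed B hnm).mono Set.inter_subset_right
          Set.inter_subset_right
    · intro n m hnm
      refine Set.disjoint_left.2 ?_
      rintro _ ⟨x, hx, rfl⟩ ⟨y, hy, hxy⟩
      refine hnm (hsame n m x y hx hy ?_)
      rw [← hQφ n x, ← hQφ m y, hxy]
  · intro _ hx' _ hy' hxy
    obtain ⟨n, x, hx, rfl⟩ := Set.mem_iUnion.1 hx'
    obtain ⟨m, y, hy, rfl⟩ := Set.mem_iUnion.1 hy'
    rw [hQV, map_sub, hQφ, hQφ, sub_eq_zero] at hxy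
    obtain rfl := hsame n m x y hx hy hxy
    refine ⟨x, hx.1, y, hy.1, ?_⟩
    rw [hφ, hφ, hxy]
    module

end Squeeze

/-! ### Iterated contraction along a flag -/

section Minima

variable {E : Type*} [NormedAddCommGroup E] [NormedSpace ℝ E] [FiniteDimensional ℝ E]
  [MeasurableSpace E] [BorelSpace E] (μ : Measure E) [μ.IsAddHaarMeasure]

/-- Squeezing a ball along a flag `U` so that two points of the resulting set which differ by an
element of `U (j + 1)` are at distance less than `l j / l m` times the diameter of the ball. -/
theorem exists_iterated_squeeze (l : ℕ → ℝ) (hl : ∀ j, 0 < l j) (hmono : Monotone l)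
    (U : ℕ → Submodule ℝ E) (hU : Monotone U) (hdim : ∀ j, finrank ℝ (U j) ≤ j)
    (R : ℝ) (m : ℕ) :
    ∃ A ⊆ Metric.ball (0 : E) R, MeasurableSet A ∧
      ENNReal.ofReal (∏ j ∈ Finset.range m, l j / l m) * μ (Metric.ball (0 : E) R) ≤ μ A ∧
      ∀ j < m, ∀ x ∈ A, ∀ y ∈ A, x - y ∈ U (j + 1) → ‖x - y‖ < l j / l m * (2 * R) := by
  induction m with
  | zero => exact ⟨_, subset_rfl, measurableSet_ball, by simp, by simp⟩
  | succ m ih =>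
    obtain ⟨A, hAR, hA, hvol, hsep⟩ := ih
    have hθ : 0 < l m / l (m + 1) := div_pos (hl _) (hl _)
    have hθ1 : l m / l (m + 1) ≤ 1 := (div_le_one (hl _)).2 (hmono m.le_succ)
    obtain ⟨A', hA'R, hA', hvol', hsep'⟩ :=
      exists_squeeze μ Metric.isOpen_ball (convex_ball 0 R) hA hAR (U (m + 1)) hθ hθ1
    refine ⟨A', hA'R, hA', ?_, ?_⟩
    · rw [hvol']
      refine le_trans ?_ (mul_le_mul_right hvol _)
      rw [← mul_assoc, ← ENNReal.ofReal_mul (by positivity)]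
      refine mul_le_mul_left (ENNReal.ofReal_le_ofReal ?_) _
      have hprod : (0 : ℝ) ≤ ∏ j ∈ Finset.range m, l j / l m :=
        Finset.prod_nonneg fun j _ => (div_pos (hl _) (hl _)).le
      -- Since the ratio is at most 1, `finrank (U (m + 1)) ≤ m + 1` costs at most its power `m +
      -- 1`, which telescopes.
      calc ∏ j ∈ Finset.range (m + 1), l j / l (m + 1)
          = (l m / l (m + 1)) ^ (m + 1) * ∏ j ∈ Finset.range m, l j / l m := by
            have hm := (hl m).ne'
            have hm' := (hl (m + 1)).ne'
            rw [Finset.prod_range_succ, Finset.prod_div_distrib, Finset.prod_div_distrib]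
            simp only [Finset.prod_const, Finset.card_range]
            rw [div_pow]
            field_simp
            ring
        _ ≤ _ := mul_le_mul_of_nonneg_right
            (pow_le_pow_of_le_one hθ.le hθ1 (hdim (m + 1))) hprod
    · intro j hj x hx y hy hxy
      obtain ⟨x', hx', y', hy', heq⟩ := hsep' x hx y hy (hU (by omega) hxy)
      have hlm := hl m
      have hlm' := hl (m + 1)
      have hn : ‖x - y‖ = l m / l (m + 1) * ‖x' - y'‖ := by
        rw [heq, norm_smul, Real.norm_of_nonneg hθ.le]
      rw [hn]
      rcases Nat.lt_succ_iff_lt_or_eq.1 hj with hj | rfl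
      · have hxy' : x' - y' ∈ U (j + 1) := by
          rw [heq] at hxy
          exact ((U (j + 1)).smul_mem_iff hθ.ne').1 hxy
        calc l m / l (m + 1) * ‖x' - y'‖ < l m / l (m + 1) * (l j / l m * (2 * R)) :=
              mul_lt_mul_of_pos_left (hsep j hj x' hx' y' hy' hxy') hθ
          _ = _ := by field_simp
      · refine mul_lt_mul_of_pos_left ?_ hθ
        have h1 := mem_ball_zero_iff.1 (hAR hx')
        have h2 := mem_ball_zero_iff.1 (hAR hy')
        linarith [norm_sub_le x' y']

end Minima

/-! ### Minkowski's second theorem for the cube -/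

section Cube

variable {d : ℕ} (Λ : Submodule ℤ (Fin d → ℝ))

theorem mem_smul_cube {r : ℝ} (hr : 0 < r) (x : Fin d → ℝ) : x ∈ r • cube d ↔ ‖x‖ ≤ r := by
  rw [cube, smul_unitClosedBall, mem_closedBall_zero_iff, Real.norm_of_nonneg hr.le]

theorem bddBelow_successiveMinimum (M : Set (Fin d → ℝ)) (p : ℕ) :
    BddBelow {r : ℝ | 0 < r ∧ ∃ v : Fin p → (Fin d → ℝ),
      LinearIndependent ℝ v ∧ ∀ i, v i ∈ Λ ∧ v i ∈ r • M} :=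
  ⟨0, fun _ hr => hr.1.le⟩

theorem successiveMinimum_nonneg (M : Set (Fin d → ℝ)) (p : ℕ) : 0 ≤ successiveMinimum Λ M p :=
  Real.sInf_nonneg fun _ hr => hr.1.le

theorem successiveMinimum_cube_le {p : ℕ} {r : ℝ} (hr : 0 < r) (v : Fin p → (Fin d → ℝ))
    (hv : LinearIndependent ℝ v) (hvΛ : ∀ i, v i ∈ Λ) (hvr : ∀ i, ‖v i‖ ≤ r) :
    successiveMinimum Λ (cube d) p ≤ r :=
  csInf_le (bddBelow_successiveMinimum Λ _ p)
    ⟨hr, v, hv, fun i => ⟨hvΛ i, (mem_smul_cube hr _).2 (hvr i)⟩⟩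

/-- The span of the lattice vectors shorter than the `p`-th minimum has dimension less than `p`. -/
theorem finrank_span_lt_successiveMinimum {p : ℕ} (hp : 0 < p) :
    finrank ℝ (Submodule.span ℝ {x | x ∈ Λ ∧ ‖x‖ < successiveMinimum Λ (cube d) p}) < p := by
  by_contra! hcon
  obtain ⟨f, hf, -, hli⟩ := Submodule.exists_fun_fin_finrank_span_eq ℝ
    {x | x ∈ Λ ∧ ‖x‖ < successiveMinimum Λ (cube d) p}
  let g : Fin p → (Fin d → ℝ) := f ∘ Fin.castLE hcon
  have hg : LinearIndependent ℝ g := hli.comp _ (Fin.castLE_injective hcon)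
  have : Nonempty (Fin p) := ⟨⟨0, hp⟩⟩
  -- The longest of finitely many vectors is an admissible radius still strictly below the minimum.
  obtain ⟨i, hi⟩ := Finite.exists_max fun i => ‖g i‖
  exact (hf (Fin.castLE hcon i)).2.not_ge
    (successiveMinimum_cube_le Λ (norm_pos_iff.2 (hg.ne_zero i)) g hg (fun j => (hf _).1) hi)

variable [DiscreteTopology Λ] [IsZLattice ℝ Λ]

theorem linearIndependent_basis :
    LinearIndependent ℝ fun i => (IsZLattice.basis Λ i : Fin d → ℝ) := by
  simpa only [← Basis.ofZLatticeBasis_apply ℝ Λ] using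
    ((IsZLattice.basis Λ).ofZLatticeBasis ℝ Λ).linearIndependent

theorem nonempty_successiveMinimum_cube {p : ℕ} (hp : p ≤ d) :
    {r : ℝ | 0 < r ∧ ∃ v : Fin p → (Fin d → ℝ),
      LinearIndependent ℝ v ∧ ∀ i, v i ∈ Λ ∧ v i ∈ r • cube d}.Nonempty := by
  let b := IsZLattice.basis Λ
  have hr : 0 < 1 + ∑ i, ‖(b i : Fin d → ℝ)‖ :=
    add_pos_of_pos_of_nonneg one_pos (Finset.sum_nonneg fun _ _ => norm_nonneg _)
  refine ⟨_, hr, fun i => b (Fin.castLE hp i),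
    (linearIndependent_basis Λ).comp _ (Fin.castLE_injective hp), fun i => ⟨(b _).2, ?_⟩⟩
  rw [mem_smul_cube hr]
  have := Finset.single_le_sum (f := fun i => ‖(b i : Fin d → ℝ)‖) (fun _ _ => norm_nonneg _)
    (Finset.mem_univ (Fin.castLE hp i))
  linarith

theorem successiveMinimum_cube_mono {p q : ℕ} (hpq : p ≤ q) (hq : q ≤ d) :
    successiveMinimum Λ (cube d) p ≤ successiveMinimum Λ (cube d) q := by
  refine csInf_le_csInf (bddBelow_successiveMinimum Λ _ p)
    (nonempty_successiveMinimum_cube Λ hq) ?_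
  rintro r ⟨hr, v, hv, h⟩
  exact ⟨hr, v ∘ Fin.castLE hpq, hv.comp _ (Fin.castLE_injective hpq), fun i => h _⟩

/-- Greedy choice: among `p + 1` independent vectors, one lies outside the span of the `p` already
chosen. The slack `ε` avoids proving that the infimum is attained. -/
theorem exists_linearIndependent_norm_lt {ε : ℝ} (hε : 0 < ε) {p : ℕ} (hp : p ≤ d) :
    ∃ v : Fin p → (Fin d → ℝ), LinearIndependent ℝ v ∧ (∀ i, v i ∈ Λ) ∧
      ∀ i, ‖v i‖ < successiveMinimum Λ (cube d) (i + 1) + ε := by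
  induction p with
  | zero => exact ⟨Fin.elim0, linearIndependent_empty_type, fun i => i.elim0, fun i => i.elim0⟩
  | succ p ih =>
    obtain ⟨v, hv, hvΛ, hvn⟩ := ih (by omega)
    obtain ⟨r, ⟨hr, w, hw, hwr⟩, hlt⟩ := exists_lt_of_csInf_lt
      (nonempty_successiveMinimum_cube Λ hp) (lt_add_of_pos_right _ hε)
    change r < successiveMinimum Λ (cube d) (p + 1) + ε at hlt
    obtain ⟨i, hi⟩ : ∃ i, w i ∉ Submodule.span ℝ (Set.range v) := by
      by_contra! hcon
      have hle : Submodule.span ℝ (Set.range w) ≤ Submodule.span ℝ (Set.range v) :=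
        Submodule.span_le.2 (Set.range_subset_iff.2 hcon)
      have := Submodule.finrank_mono hle
      rw [finrank_span_eq_card hw, finrank_span_eq_card hv] at this
      simp at this
    refine ⟨Fin.snoc v (w i), linearIndependent_finSnoc.2 ⟨hv, hi⟩, ?_, ?_⟩
    · intro j
      refine Fin.lastCases ?_ (fun j => ?_) j
      · simpa using (hwr i).1
      · simpa using hvΛ j
    · intro j
      refine Fin.lastCases ?_ (fun j => ?_) j
      · simpa using ((mem_smul_cube hr _).1 (hwr i).2).trans_lt hlt
      · simpa using hvn j

theorem abs_det_le_factorial_mul_prod (A : Matrix (Fin d) (Fin d) ℝ) (c : Fin d → ℝ)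
    (h : ∀ i j, |A i j| ≤ c i) : |A.det| ≤ d.factorial * ∏ i, c i := by
  rw [Matrix.det_apply]
  calc |∑ σ : Equiv.Perm (Fin d), Equiv.Perm.sign σ • ∏ i, A (σ i) i|
      ≤ ∑ σ : Equiv.Perm (Fin d), |Equiv.Perm.sign σ • ∏ i, A (σ i) i| :=
        Finset.abs_sum_le_sum_abs _ _
    _ ≤ ∑ _σ : Equiv.Perm (Fin d), ∏ i, c i := by
        refine Finset.sum_le_sum fun σ _ => ?_
        rw [Units.smul_def, zsmul_eq_mul, abs_mul, ← Int.cast_abs, Int.isUnit_iff_abs_eq.1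
          (Equiv.Perm.sign σ).isUnit, Int.cast_one, one_mul, Finset.abs_prod,
          ← Equiv.prod_comp σ c]
        exact Finset.prod_le_prod (fun _ _ => abs_nonneg _) fun i _ => h _ _
    _ = d.factorial * ∏ i, c i := by
        simp [Fintype.card_perm]

/-- The coordinates in a lattice basis form an integer matrix whose determinant is nonzero, hence at
least 1 in absolute value. -/
theorem covolume_le_abs_det (v : Fin d → (Fin d → ℝ)) (hv : LinearIndependent ℝ v)
    (hvΛ : ∀ i, v i ∈ Λ) : ZLattice.covolume Λ ≤ |(Matrix.of v).det| := by
  let b := IsZLattice.basis Λ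
  let N : Matrix (Fin d) (Fin d) ℤ := Matrix.of fun i j => b.repr ⟨v i, hvΛ i⟩ j
  have hN : Matrix.of v = N.map (Int.castRingHom ℝ) * Matrix.of ((↑) ∘ b) := by
    ext i k
    have h := congrArg (fun x : Λ => (x : Fin d → ℝ) k) (b.sum_repr ⟨v i, hvΛ i⟩)
    simp only [Submodule.coe_sum, Finset.sum_apply] at h
    simp only [Matrix.mul_apply, Matrix.of_apply, Matrix.map_apply, N, Function.comp]
    rw [← h]
    refine Finset.sum_congr rfl fun j _ => ?_
    simp
  have hdet : (Matrix.of v).det = (N.det : ℝ) * (Matrix.of ((↑) ∘ b)).det := by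
    rw [hN, Matrix.det_mul, ← RingHom.mapMatrix_apply, ← RingHom.map_det]
    rfl
  have hne : (Matrix.of v).det ≠ 0 := by
    have hu : IsUnit (Matrix.of v) := Matrix.linearIndependent_rows_iff_isUnit.1 hv
    exact ((Matrix.isUnit_iff_isUnit_det _).1 hu).ne_zero
  have hN0 : N.det ≠ 0 := by
    intro h0
    rw [hdet, h0] at hne
    simp at hne
  rw [ZLattice.covolume_eq_det Λ b, hdet, abs_mul]
  have : (1 : ℝ) ≤ |(N.det : ℝ)| := by
    exact_mod_cast Int.one_le_abs hN0
  exact le_mul_of_one_le_left (abs_nonneg _) this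

/-- The lower bound in Minkowski's second theorem for the cube. -/
theorem covolume_le_factorial_mul_prod_successiveMinimum :
    ZLattice.covolume Λ ≤
      d.factorial * ∏ i : Fin d, successiveMinimum Λ (cube d) (i + 1) := by
  have hlim : Tendsto (fun ε : ℝ => (d.factorial : ℝ) *
      ∏ i : Fin d, (successiveMinimum Λ (cube d) (i + 1) + ε)) (𝓝[>] 0)
      (𝓝 (d.factorial * ∏ i : Fin d, (successiveMinimum Λ (cube d) (i + 1) + 0))) := by
    refine Tendsto.mono_left (Continuous.tendsto ?_ 0) nhdsWithin_le_nhds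
    fun_prop
  simp only [add_zero] at hlim
  refine ge_of_tendsto hlim ?_
  filter_upwards [self_mem_nhdsWithin] with ε hε
  obtain ⟨v, hv, hvΛ, hvn⟩ := exists_linearIndependent_norm_lt Λ hε le_rfl
  exact (covolume_le_abs_det Λ v hv hvΛ).trans
    (abs_det_le_factorial_mul_prod _ _ fun i j => (norm_le_pi_norm (v i) j).trans (hvn i).le)

theorem successiveMinimum_cube_pos {p : ℕ} (hp0 : 0 < p) (hp : p ≤ d) :
    0 < successiveMinimum Λ (cube d) p := by
  refine (successiveMinimum_nonneg Λ _ p).lt_of_ne' fun h0 => ?_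
  have h := covolume_le_factorial_mul_prod_successiveMinimum Λ
  rw [Finset.prod_eq_zero (Finset.mem_univ (⟨p - 1, by omega⟩ : Fin d))
    (by simpa [Nat.sub_add_cancel hp0] using h0), mul_zero] at h
  exact h.not_gt (ZLattice.covolume_pos Λ)

/-- Blichfeldt's principle: the lattice translates of `A` cannot all be disjoint. -/
theorem exists_sub_mem_of_covolume_lt {A : Set (Fin d → ℝ)} (hA : MeasurableSet A)
    (h : ENNReal.ofReal (ZLattice.covolume Λ) < volume A) :
    ∃ x ∈ A, ∃ y ∈ A, x ≠ y ∧ x - y ∈ Λ := by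
  let b := IsZLattice.basis Λ
  have fund := ZLattice.isAddFundamentalDomain b (volume : Measure (Fin d → ℝ))
  have hF : volume (ZSpan.fundamentalDomain (b.ofZLatticeBasis ℝ)) < volume A := by
    rwa [ZLattice.covolume_eq_measure_fundamentalDomain Λ volume fund, measureReal_def,
      ENNReal.ofReal_toReal (ZSpan.fundamentalDomain_isBounded _).measure_lt_top.ne] at h
  have : MeasurableVAdd Λ (Fin d → ℝ) :=
    (inferInstance : MeasurableVAdd Λ.toAddSubgroup (Fin d → ℝ))
  have : VAddInvariantMeasure Λ (Fin d → ℝ) volume :=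
    (inferInstance : VAddInvariantMeasure Λ.toAddSubgroup (Fin d → ℝ) volume)
  obtain ⟨g, g', hgg, hdis⟩ :=
    exists_pair_mem_lattice_not_disjoint_vadd fund hA.nullMeasurableSet hF
  obtain ⟨_, ⟨x, hx, rfl⟩, y, hy, hxy⟩ := Set.not_disjoint_iff.1 hdis
  have hxy' : (g' : Fin d → ℝ) + y = g + x := hxy
  have hsub : x - y = ((g' - g : Λ) : Fin d → ℝ) := by
    rw [Submodule.coe_sub, sub_eq_sub_iff_add_eq_add, add_comm x, ← hxy']
  refine ⟨x, hx, y, hy, ?_, hsub ▸ (g' - g).2⟩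
  rintro rfl
  rw [sub_self] at hsub
  exact hgg (sub_eq_zero.1 (Subtype.ext hsub.symm)).symm

/-- The upper bound in Minkowski's second theorem for the cube. -/
theorem prod_successiveMinimum_le_covolume :
    ∏ i : Fin d, successiveMinimum Λ (cube d) (i + 1) ≤ ZLattice.covolume Λ := by
  obtain rfl | ⟨n, rfl⟩ : d = 0 ∨ ∃ n, d = n + 1 := by
    cases d <;> simp
  · rw [ZLattice.covolume_eq_det Λ (IsZLattice.basis Λ)]
    simp
  -- Truncation keeps `l` positive and monotone: beyond the dimension the defining set is empty and
  -- `sInf` is 0.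
  let l : ℕ → ℝ := fun j => successiveMinimum Λ (cube (n + 1)) (min j n + 1)
  have hl : ∀ j, 0 < l j := fun j => successiveMinimum_cube_pos Λ (by omega) (by omega)
  have hmono : Monotone l := fun i j hij => successiveMinimum_cube_mono Λ (by omega) (by omega)
  let U : ℕ → Submodule ℝ (Fin (n + 1) → ℝ) := fun j => Submodule.span ℝ {x | x ∈ Λ ∧ ‖x‖ < l j}
  have hU : Monotone U := fun i j hij =>
    Submodule.span_mono fun x hx => ⟨hx.1, hx.2.trans_le (hmono hij)⟩
  have hdim : ∀ j, finrank ℝ (U j) ≤ j := by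
    intro j
    have := finrank_span_lt_successiveMinimum Λ (p := min j n + 1) (by omega)
    have h2 : finrank ℝ (U j) < min j n + 1 := this
    omega
  have hprod : ∏ i : Fin (n + 1), successiveMinimum Λ (cube (n + 1)) (i + 1) =
      ∏ j ∈ Finset.range (n + 1), l j := by
    rw [Finset.prod_range]
    refine Finset.prod_congr rfl fun i _ => ?_
    simp only [l]
    rw [min_eq_left (by omega)]
  -- The ball of radius `l n / 2` has volume `l n ^ (n + 1)`, cancelling the denominators exactly.
  obtain ⟨A, hAR, hA, hvol, hsep⟩ :=
    exists_iterated_squeeze (volume : Measure (Fin (n + 1) → ℝ)) l hl hmono U hU hdim (l n / 2) n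
  rw [hprod]
  by_contra! hcon
  have hvolA : ENNReal.ofReal (∏ j ∈ Finset.range (n + 1), l j) ≤ volume A := by
    refine le_trans (le_of_eq ?_) hvol
    have hn := hl n
    rw [Real.volume_pi_ball _ (by positivity), ← ENNReal.ofReal_mul
      (Finset.prod_nonneg fun j _ => (div_pos (hl _) (hl _)).le)]
    congr 1
    rw [Finset.prod_range_succ, Finset.prod_div_distrib]
    simp only [Finset.prod_const, Finset.card_range, Fintype.card_fin]
    field_simp
    ring
  obtain ⟨x, hx, y, hy, hne, hmem⟩ := exists_sub_mem_of_covolume_lt Λ hA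
    (((ENNReal.ofReal_lt_ofReal_iff_of_nonneg (ZLattice.covolume_pos Λ).le).2 hcon).trans_le hvolA)
  -- Descent: a lattice vector shorter than `l (j + 1)` lies in `U (j + 1)`, so `hsep` makes it
  -- shorter than `l j`.
  have hlt : ∀ k ≤ n, ‖x - y‖ < l (n - k) := by
    intro k
    induction k with
    | zero =>
      intro _
      have h1 := mem_ball_zero_iff.1 (hAR hx)
      have h2 := mem_ball_zero_iff.1 (hAR hy)
      simp only [Nat.sub_zero]
      linarith [norm_sub_le x y]
    | succ k ih =>
      intro hk
      have hxy : x - y ∈ U (n - (k + 1) + 1) := by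
        rw [show n - (k + 1) + 1 = n - k by omega]
        exact Submodule.subset_span ⟨hmem, ih (by omega)⟩
      have := hsep (n - (k + 1)) (by omega) x hx y hy hxy
      have hn := (hl n).ne'
      rwa [mul_div_cancel₀ _ two_ne_zero, div_mul_cancel₀ _ hn] at this
  have h0 : x - y ∈ U 0 := Submodule.subset_span ⟨hmem, by simpa using hlt n le_rfl⟩
  have hbot : U 0 = ⊥ := Submodule.finrank_eq_zero.1 (Nat.le_zero.1 (hdim 0))
  rw [hbot, Submodule.mem_bot, sub_eq_zero] at h0
  exact hne h0

end Cube

/-! ### Reduction of boxes to the cube, and logarithms -/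

section Box

variable {d : ℕ} (Λ : Submodule ℤ (Fin d → ℝ))

theorem successiveMinimum_image (e : (Fin d → ℝ) ≃L[ℝ] (Fin d → ℝ)) (M : Set (Fin d → ℝ)) (p : ℕ) :
    successiveMinimum Λ (e '' M) p =
      successiveMinimum (ZLattice.comap ℝ Λ e.toLinearMap) M p := by
  have hmem : ∀ (r : ℝ) (x : Fin d → ℝ), e x ∈ r • e '' M ↔ x ∈ r • M := by
    intro r x
    constructor
    · rintro ⟨_, ⟨y, hy, rfl⟩, hxy⟩
      refine ⟨y, hy, e.injective ?_⟩
      simpa using hxy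
    · rintro ⟨y, hy, rfl⟩
      exact ⟨e y, ⟨y, hy, rfl⟩, by simp⟩
  unfold successiveMinimum
  congr 1
  ext r
  refine and_congr_right fun _ => ⟨?_, ?_⟩
  · rintro ⟨v, hv, h⟩
    refine ⟨fun i => e.symm (v i), hv.map' e.symm.toLinearMap e.symm.toLinearEquiv.ker, fun i => ?_⟩
    refine ⟨?_, (hmem r _).1 (by simpa using (h i).2)⟩
    change e (e.symm (v i)) ∈ Λ
    simpa using (h i).1
  · rintro ⟨v, hv, h⟩
    exact ⟨fun i => e (v i), hv.map' e.toLinearMap e.toLinearEquiv.ker,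
      fun i => ⟨(h i).1, (hmem r _).2 (h i).2⟩⟩

theorem det_diagExp {t : Fin d → ℝ} (ht : ∑ i, t i = 0) : (diagExp t).det = 1 := by
  rw [diagExp, Matrix.det_diagonal, ← Real.exp_sum, ht, Real.exp_zero]

/-- The multiplication by `diagExp t` as a continuous linear equivalence, when `∑ i, t i = 0`. -/
noncomputable def diagExpEquiv (t : Fin d → ℝ) (ht : ∑ i, t i = 0) :
    (Fin d → ℝ) ≃L[ℝ] (Fin d → ℝ) :=
  (LinearMap.equivOfDetNeZero (Matrix.toLin' (diagExp t))
    (by rw [LinearMap.det_toLin', det_diagExp ht]; exact one_ne_zero)).toContinuousLinearEquiv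

theorem coe_diagExpEquiv (t : Fin d → ℝ) (ht : ∑ i, t i = 0) :
    ⇑(diagExpEquiv t ht) = Matrix.toLin' (diagExp t) := rfl

theorem measurePreserving_diagExpEquiv (t : Fin d → ℝ) (ht : ∑ i, t i = 0) :
    MeasurePreserving (diagExpEquiv t ht) volume volume := by
  refine ⟨(diagExpEquiv t ht).continuous.measurable, ?_⟩
  have hdet : LinearMap.det (Matrix.toLin' (diagExp t)) = 1 := by
    rw [LinearMap.det_toLin', det_diagExp ht]
  rw [coe_diagExpEquiv, Real.map_linearMap_volume_pi_eq_smul_volume_pi (by simp [hdet]), hdet]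
  simp

variable [DiscreteTopology Λ] [IsZLattice ℝ Λ]

/-- Minkowski's second theorem for the parallelepipeds `box τ s` and unimodular lattices. -/
theorem prod_successiveMinimum_box (hΛ : ZLattice.covolume Λ = 1) (τ : ℝ → Fin d → ℝ) (s : ℝ)
    (hτ : ∑ i, τ s i = 0) :
    (∀ i : Fin d, 0 < successiveMinimum Λ (box τ s) (i + 1)) ∧
      1 ≤ d.factorial * ∏ i : Fin d, successiveMinimum Λ (box τ s) (i + 1) ∧
      ∏ i : Fin d, successiveMinimum Λ (box τ s) (i + 1) ≤ 1 := by
  let e := diagExpEquiv (τ s) hτ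
  have hbox : ∀ p, successiveMinimum Λ (box τ s) p =
      successiveMinimum (ZLattice.comap ℝ Λ e.toLinearMap) (cube d) p :=
    fun p => successiveMinimum_image Λ e (cube d) p
  have hcov : ZLattice.covolume (ZLattice.comap ℝ Λ e.toLinearMap) = 1 :=
    (ZLattice.covolume_comap Λ volume volume (measurePreserving_diagExpEquiv (τ s) hτ)).trans hΛ
  simp_rw [hbox]
  refine ⟨fun i => successiveMinimum_cube_pos _ (by omega) (by omega), ?_, ?_⟩
  · exact hcov ▸ covolume_le_factorial_mul_prod_successiveMinimum _
  · exact hcov ▸ prod_successiveMinimum_le_covolume _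

theorem neg_sum_psi_bounds (hΛ : ZLattice.covolume Λ = 1) (τ : ℝ → Fin d → ℝ) {s : ℝ}
    (hs : 0 < s) (hτ : ∑ i, τ s i = 0) :
    0 ≤ -∑ i ∈ Finset.Icc 1 d, psi Λ τ i s ∧
      -∑ i ∈ Finset.Icc 1 d, psi Λ τ i s ≤ Real.log d.factorial * s⁻¹ := by
  obtain ⟨hpos, hlow, hup⟩ := prod_successiveMinimum_box Λ hΛ τ s hτ
  have hsum : ∑ i ∈ Finset.Icc 1 d, psi Λ τ i s =
      Real.log (∏ i : Fin d, successiveMinimum Λ (box τ s) (i + 1)) * s⁻¹ := by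
    rw [Real.log_prod fun i _ => (hpos i).ne', Finset.sum_mul,
      ← Finset.sum_range fun i => Real.log (successiveMinimum Λ (box τ s) (i + 1)) * s⁻¹,
      Finset.range_eq_Ico, Finset.sum_Ico_add' (fun i => Real.log
        (successiveMinimum Λ (box τ s) i) * s⁻¹) 0 d 1]
    rfl
  have hP : 0 < ∏ i : Fin d, successiveMinimum Λ (box τ s) (i + 1) :=
    Finset.prod_pos fun i _ => hpos i
  have hs' : 0 < s⁻¹ := inv_pos.2 hs
  rw [hsum, ← neg_mul]
  refine ⟨mul_nonneg (neg_nonneg.2 (Real.log_nonpos hP.le hup)) hs'.le,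
    mul_le_mul_of_nonneg_right ?_ hs'.le⟩
  have h := Real.log_nonneg hlow
  rw [Real.log_mul (by positivity) hP.ne'] at h
  linarith

end Box

end Schmidt

theorem mainTheorem6 (d : ℕ) :
    ∃ C : ℝ, ∀ (Λ : Submodule ℤ (Fin d → ℝ)) [DiscreteTopology Λ] [IsZLattice ℝ Λ],
      ZLattice.covolume Λ = 1 →
      ∀ τ : ℝ → Fin d → ℝ, (∀ s : ℝ, 0 < s → ∑ i, τ s i = 0) →
        (∀ s : ℝ, 0 < s →
          0 ≤ -∑ i ∈ Finset.Icc 1 d, Schmidt.psi Λ τ i s ∧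
          -∑ i ∈ Finset.Icc 1 d, Schmidt.psi Λ τ i s ≤ C * s⁻¹) ∧
        Schmidt.lowerPsi Λ τ d = 0 ∧
        Schmidt.upperPsi Λ τ d = 0 ∧
        Tendsto (fun s : ℝ => ∑ i ∈ Finset.Icc 1 d, Schmidt.psi Λ τ i s) atTop (𝓝 0) := by
  refine ⟨Real.log d.factorial, fun Λ _ _ hΛ τ hτ => ?_⟩
  have hbd : ∀ s : ℝ, 0 < s → _ := fun s hs => Schmidt.neg_sum_psi_bounds Λ hΛ τ hs (hτ s hs)
  have hinv : Tendsto (fun s : ℝ => Real.log d.factorial * s⁻¹) atTop (𝓝 0) := by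
    simpa using tendsto_inv_atTop_zero.const_mul (Real.log d.factorial)
  have hneg : Tendsto (fun s : ℝ => -∑ i ∈ Finset.Icc 1 d, Schmidt.psi Λ τ i s) atTop (𝓝 0) :=
    squeeze_zero' ((eventually_gt_atTop 0).mono fun s hs => (hbd s hs).1)
      ((eventually_gt_atTop 0).mono fun s hs => (hbd s hs).2) hinv
  have hlim : Tendsto (fun s : ℝ => ∑ i ∈ Finset.Icc 1 d, Schmidt.psi Λ τ i s) atTop (𝓝 0) := by
    simpa using hneg.neg
  have hE : Tendsto (fun s : ℝ => (Schmidt.psiSum Λ τ d s : EReal)) atTop (𝓝 0) :=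
    (continuous_coe_real_ereal.tendsto 0).comp hlim
  exact ⟨hbd, hE.liminf_eq, hE.limsup_eq, hlim⟩
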